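/- For $\omega<1$ and $-1<\phi<1$ let $$V(\phi)=\tfrac12(\omega-\phi^2)+\tfrac12(1-\omega)\log\frac{1-\omega}{1-\phi^2},\qquad E(\phi,\phi')=\tfrac12(\phi')^2+V(\phi),\qquad \mathcal E_\omega=V(0)=\tfrac12\omega+\tfrac12(1-\omega)\log(1-\omega),$$ where $E$ is the conserved energy of Newton's equation $\phi''=-V'(\phi)=\frac{(\omega-\phi^2)\phi}{1-\phi^2}$. The period function is $$T(\mathcal E,\omega)=\oint\frac{d\phi}{\sqrt{2(\mathcal E-V(\phi))}}=2\int_m^M\frac{d\phi}{\sqrt{2(\mathcal E-V(\phi))}},$$ the line integral along the closed orbit of energy $\mathcal E$, on which $\phi$ ranges over $[m,M]$. For $\omega\in(0,1)$ and $\mathcal E\in(0,\mathcal E_\omega)$ this is the orbit of energy $\mathcal E$ in the half-plane $\phi>0$ (even waves, inside the homoclinic orbit; $0<m<M<1$ are the roots of $V=\mathcal E$ in $(0,1)$). For $\omega<1$ and $\mathcal E>\mathcal E_\omega$ it is the whole level curve $E=\mathcal E$ in the strip $|\phi|<1$ (odd waves; $m=-M$, where $M$ is the root of $V=\mathcal E$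 in $(0,1)$). Theorem. In all these cases the integral converges. If $\omega\in(0,1)$, then $\mathcal E\mapsto T(\mathcal E,\omega)$ is $C^1$ on $(0,\infty)\setminus\{\mathcal E_\omega\}$; if $\omega\in(-\infty,0)$, then it is $C^1$ on $(\mathcal E_\omega,\infty)$. For every $\omega\in(0,1)$ the map $\mathcal E\mapsto T(\mathcal E,\omega)$ is strictly increasing on $(0,\mathcal E_\omega)$. For every $\omega\in(-\infty,1)$ it is strictly decreasing on $(\mathcal E_\omega,\infty)$. -/

import Mathlib

noncomputable section

namespace NLSIDD

/-- The potential energy `V` of Newton's equation `φ'' = -V'(φ)`, used for `ω < 1`, `-1 < φ < 1`. -/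
def potential (ω φ : ℝ) : ℝ :=
  (1 / 2) * (ω - φ ^ 2) + (1 / 2) * (1 - ω) * Real.log ((1 - ω) / (1 - φ ^ 2))

/-- The conserved energy `E(φ, ξ) = ξ² / 2 + V(φ)`, where `ξ = φ'`. -/
def energy (ω φ ξ : ℝ) : ℝ :=
  (1 / 2) * ξ ^ 2 + potential ω φ

/-- The energy level of the equilibrium `(0, 0)`: the homoclinic level if `0 < ω < 1`,
the level of the center if `ω ≤ 0`. -/
def criticalEnergy (ω : ℝ) : ℝ :=
  energy ω 0 0

/-- The periodic orbit of energy `𝓔` in the phase plane. For `0 < ω < 1` and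
`0 < 𝓔 < criticalEnergy ω` the level curve consists of two closed orbits, exchanged by
`φ ↦ -φ`; the one in the half-plane `φ > 0` (the even wave) is taken. For
`𝓔 > criticalEnergy ω` it is the whole level curve in the strip `-1 < φ < 1` (the odd wave). -/
def periodicOrbit (ω 𝓔 : ℝ) : Set (ℝ × ℝ) :=
  {p | -1 < p.1 ∧ p.1 < 1 ∧ energy ω p.1 p.2 = 𝓔 ∧ (𝓔 < criticalEnergy ω → 0 < p.1)}

/-- The range `[m, M]` of `φ` along the periodic orbit: its projection to the `φ`-axis. -/
def orbitRange (ω 𝓔 : ℝ) : Set ℝ :=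
  Prod.fst '' periodicOrbit ω 𝓔

/-- The integrand `1 / √(2 (𝓔 - V(φ)))` of the period function. -/
def periodIntegrand (ω 𝓔 φ : ℝ) : ℝ :=
  1 / Real.sqrt (2 * (𝓔 - potential ω φ))

/-- The period function `T(𝓔, ω) = ∮ dφ / √(2 (𝓔 - V(φ)))`, the line integral of `dφ / φ'` along
the closed orbit. The orbit consists of the two branches `φ' = ± √(2 (𝓔 - V(φ)))` over
`orbitRange ω 𝓔`, traversed in opposite directions, and each contributes the same integral. -/
def period (𝓔 ω : ℝ) : ℝ :=
  2 * ∫ φ in orbitRange ω 𝓔, periodIntegrand ω 𝓔 φ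

end NLSIDD

end

/-!
Both branches of the period are turned into integrals over a fixed phase interval
`θ ∈ [-π/2, π/2]` of a smooth integrand, whose monotonicity in the energy is then read off.

For an odd wave put `φ = √s * sin θ`. As a function of `φ ^ 2` the potential energy drops from `s`
to `s * sin θ ^ 2` by `s * cos θ ^ 2 / 2` times a difference quotient `oddDrop`, so half the period
is the integral of `1 / √oddDrop`. This quotient increases with `s`, and `s` with the energy.

For an even wave put `a = 1 - ω` and `x = (1 - φ ^ 2) / a`, so that the potential energy is
`a / 2 * (x - 1 - log x)`, that is `a / 4 * z ^ 2` with `z` the signed square root of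
`2 * (x - 1 - log x)`. On the orbit of energy `a / 4 * r ^ 2` put `z = r * sin θ`; the period is a
multiple of `∫ P (r * sin θ) dθ`, where `P` is proportional to `dφ / dz`. If `P` is strictly convex,
`P z + P (-z)` increases with `z ≥ 0`, hence the integral with `r`. Convexity of `P` is the
monotonicity of an explicit expression in the moments `∫ s ^ k * x / (1 + s * (x - 1)) ds`, which
themselves increase with `x`.
-/

noncomputable section

open Set Filter Topology MeasureTheory Real

namespace NLSIDD

section ParametricIntegral

universe u

variable {E G : Type u} [NormedAddCommGroup E] [NormedAddCommGroup G]
  {F : E → ℝ → G} {x₀ : E} {a b : ℝ}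

theorem exists_eventually_norm_le_of_continuousAt {K : Set ℝ} (hK : IsCompact K)
    (hF : ∀ t ∈ K, ContinuousAt (Function.uncurry F) (x₀, t)) :
    ∃ C, ∀ᶠ x in 𝓝 x₀, ∀ t ∈ K, ‖F x t‖ ≤ C := by
  obtain ⟨C, hC⟩ := hK.exists_bound_of_continuousOn (f := F x₀) fun t ht =>
    ((hF t ht).comp (f := fun t => (x₀, t)) (by fun_prop)).continuousWithinAt
  refine ⟨C + 1, hK.eventually_forall_of_forall_eventually fun t ht => ?_⟩
  exact ((hF t ht).norm.eventually_lt_const ((hC t ht).trans_lt (lt_add_one C))).mono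
    fun _ h => h.le

theorem aestronglyMeasurable_restrict_uIoc_of_continuousAt {x : E}
    (hF : ∀ t ∈ uIcc a b, ContinuousAt (Function.uncurry F) (x, t)) :
    AEStronglyMeasurable (F x) (volume.restrict (uIoc a b)) :=
  (ContinuousOn.mono (fun t ht => ((hF t ht).comp (f := fun t => (x, t))
    (by fun_prop)).continuousWithinAt) uIoc_subset_uIcc).aestronglyMeasurable measurableSet_uIoc

variable [NormedSpace ℝ G]

theorem continuousAt_intervalIntegral_of_continuousAt
    (hF : ∀ᶠ x in 𝓝 x₀, ∀ t ∈ uIcc a b, ContinuousAt (Function.uncurry F) (x, t)) :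
    ContinuousAt (fun x => ∫ t in a..b, F x t) x₀ := by
  obtain ⟨C, hC⟩ := exists_eventually_norm_le_of_continuousAt isCompact_uIcc hF.self_of_nhds
  refine intervalIntegral.continuousAt_of_dominated_interval (bound := fun _ => C)
    (hF.mono fun x hx => aestronglyMeasurable_restrict_uIoc_of_continuousAt hx)
    (hC.mono fun x hx => ae_of_all _ fun t ht => hx t (uIoc_subset_uIcc ht))
    intervalIntegrable_const (ae_of_all _ fun t ht => ?_)
  exact (hF.self_of_nhds t (uIoc_subset_uIcc ht)).comp (f := fun x => (x, t)) (by fun_prop)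

variable [NormedSpace ℝ E]

theorem hasFDerivAt_intervalIntegral_of_contDiffAt
    (hF : ∀ t ∈ uIcc a b, ContDiffAt ℝ 1 (Function.uncurry F) (x₀, t)) :
    HasFDerivAt (fun x => ∫ t in a..b, F x t)
      (∫ t in a..b, (fderiv ℝ (Function.uncurry F) (x₀, t)).comp (.inl ℝ E ℝ)) x₀ := by
  have hev : ∀ᶠ x in 𝓝 x₀, ∀ t ∈ uIcc a b, ContDiffAt ℝ 1 (Function.uncurry F) (x, t) :=
    isCompact_uIcc.eventually_forall_of_forall_eventually fun t ht =>
      (hF t ht).eventually (by simp)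
  have hF' : ∀ t ∈ uIcc a b, ContinuousAt (Function.uncurry fun x t =>
      (fderiv ℝ (Function.uncurry F) (x, t)).comp (.inl ℝ E ℝ)) (x₀, t) := fun t ht =>
    (((hF t ht).fderiv_right (m := 0) (by simp)).clm_comp contDiffAt_const).continuousAt
  obtain ⟨C, hC⟩ := exists_eventually_norm_le_of_continuousAt isCompact_uIcc hF'
  refine intervalIntegral.hasFDerivAt_integral_of_dominated_of_fderiv_le (bound := fun _ => C)
    (hev.and hC)
    (hev.mono fun x hx => aestronglyMeasurable_restrict_uIoc_of_continuousAt
      fun t ht => (hx t ht).continuousAt)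
    (ContinuousOn.intervalIntegrable fun t ht => ((hF t ht).continuousAt.comp
      (f := fun t => (x₀, t)) (by fun_prop)).continuousWithinAt)
    (aestronglyMeasurable_restrict_uIoc_of_continuousAt hF')
    (ae_of_all _ fun t ht x hx => hx.2 t (uIoc_subset_uIcc ht)) intervalIntegrable_const
    (ae_of_all _ fun t ht x hx => ?_)
  exact HasFDerivAt.comp (f := fun x => (x, t)) x
    ((hx.1 t (uIoc_subset_uIcc ht)).differentiableAt one_ne_zero).hasFDerivAt
    (hasFDerivAt_prodMk_left x t)

theorem contDiffAt_intervalIntegral {n : ℕ∞}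
    (hF : ∀ t ∈ uIcc a b, ContDiffAt ℝ n (Function.uncurry F) (x₀, t)) :
    ContDiffAt ℝ n (fun x => ∫ t in a..b, F x t) x₀ := by
  suffices h : ∀ m : ℕ, (∀ t ∈ uIcc a b, ContDiffAt ℝ m (Function.uncurry F) (x₀, t)) →
      ContDiffAt ℝ m (fun x => ∫ t in a..b, F x t) x₀ from
    contDiffWithinAt_iff_forall_nat_le.2 fun m hm => h m fun t ht =>
      (hF t ht).of_le (mod_cast hm)
  intro m hm
  have hev : ∀ᶠ x in 𝓝 x₀, ∀ t ∈ uIcc a b, ContDiffAt ℝ m (Function.uncurry F) (x, t) :=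
    isCompact_uIcc.eventually_forall_of_forall_eventually fun t ht =>
      (hm t ht).eventually (by simp)
  clear hF
  induction m generalizing G with
  | zero =>
    refine contDiffAt_zero.2 ⟨_, hev.eventually_nhds, fun x hx => ?_⟩
    exact (continuousAt_intervalIntegral_of_continuousAt (hx.mono fun y hy t ht =>
      (hy t ht).continuousAt)).continuousWithinAt
  | succ m ih =>
    refine contDiffAt_succ_iff_hasFDerivAt.2 ⟨_, ⟨_, hev, fun x hx =>
      hasFDerivAt_intervalIntegral_of_contDiffAt fun t ht => (hx t ht).of_le (by simp)⟩, ?_⟩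
    have hF' : ∀ x, (∀ t ∈ uIcc a b, ContDiffAt ℝ (m + 1 : ℕ) (Function.uncurry F) (x, t)) →
        ∀ t ∈ uIcc a b, ContDiffAt ℝ m (Function.uncurry fun x t =>
          (fderiv ℝ (Function.uncurry F) (x, t)).comp (.inl ℝ E ℝ)) (x, t) := fun x hx t ht =>
      ((hx t ht).fderiv_right (m := m) (by simp)).clm_comp
        (contDiffAt_const (c := ContinuousLinearMap.inl ℝ E ℝ))
    exact ih (hF' x₀ hm) (hev.mono hF')

end ParametricIntegral

theorem contDiffAt_of_eventually_leftInverse {f g : ℝ → ℝ} {f' x : ℝ} {n : WithTop ℕ∞}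
    (hn : n ≠ 0) (hf : ContDiffAt ℝ n f x) (hf' : HasDerivAt f f' x) (h0 : f' ≠ 0)
    (hg : ∀ᶠ y in 𝓝 x, g (f y) = y) : ContDiffAt ℝ n g (f x) :=
  (hf.to_localInverse (hf'.hasFDerivAt_equiv h0) hn).congr_of_eventuallyEq
    ((hf.hasStrictFDerivAt' (hf'.hasFDerivAt_equiv h0) hn).localInverse_unique hg)

theorem integral_image_Icc {γ γ' f F : ℝ → ℝ} {α β : ℝ} (hαβ : α ≤ β)
    (hγ : ∀ θ ∈ Icc α β, HasDerivAt γ (γ' θ) θ) (hinj : InjOn γ (Icc α β))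
    (hF : ContinuousOn F (Icc α β)) (heq : ∀ θ ∈ Ioo α β, |γ' θ| * f (γ θ) = F θ) :
    IntegrableOn f (γ '' Icc α β) ∧ ∫ x in γ '' Icc α β, f x = ∫ θ in α..β, F θ := by
  have hγ' : ∀ θ ∈ Icc α β, HasDerivWithinAt γ (γ' θ) (Icc α β) θ := fun θ hθ =>
    (hγ θ hθ).hasDerivWithinAt
  have heq' : EqOn (fun θ => |γ' θ| • f (γ θ)) F (Ioo α β) := heq
  constructor
  · rw [integrableOn_image_iff_integrableOn_abs_deriv_smul measurableSet_Icc hγ' hinj,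
      integrableOn_Icc_iff_integrableOn_Ioo, integrableOn_congr_fun heq' measurableSet_Ioo]
    exact hF.integrableOn_Icc.mono_set Ioo_subset_Icc_self
  · rw [integral_image_eq_integral_abs_deriv_smul measurableSet_Icc hγ' hinj,
      integral_Icc_eq_integral_Ioo, setIntegral_congr_fun measurableSet_Ioo heq',
      intervalIntegral.integral_of_le hαβ, integral_Ioc_eq_integral_Ioo]

theorem intervalIntegral_lt_of_continuousOn {f g : ℝ → ℝ} {a b : ℝ} (hab : a < b)
    (hf : ContinuousOn f (Icc a b)) (hg : ContinuousOn g (Icc a b))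
    (h : ∀ t ∈ Ioo a b, f t < g t) : ∫ t in a..b, f t < ∫ t in a..b, g t := by
  have hle : ∀ t ∈ Icc a b, f t ≤ g t := by
    rw [← closure_Ioo hab.ne] at hf hg ⊢
    exact fun t ht => le_on_closure (fun x hx => (h x hx).le) hf hg ht
  have hmid : (a + b) / 2 ∈ Ioo a b := by constructor <;> linarith
  exact intervalIntegral.integral_lt_integral_of_continuousOn_of_le_of_exists_lt hab hf hg
    (fun t ht => hle t (Ioc_subset_Icc_self ht)) ⟨_, Ioo_subset_Icc_self hmid, h _ hmid⟩

section Swing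

/-- The integral of `P` over the swing `θ ↦ r * sin θ` of a harmonic oscillator of amplitude `r`
from one turning point to the other. -/
def swing (P : ℝ → ℝ) (r : ℝ) : ℝ :=
  ∫ θ in -(π / 2)..π / 2, P (r * sin θ)

variable {P : ℝ → ℝ} {R : ℝ}

theorem mul_sin_mem_Ioo {r : ℝ} (hr : r ∈ Ioo 0 R) (θ : ℝ) : r * sin θ ∈ Ioo (-R) R := by
  constructor <;> nlinarith [neg_one_le_sin θ, sin_le_one θ, hr.1, hr.2]

theorem contDiffOn_swing {n : ℕ∞} (hP : ContDiffOn ℝ n P (Ioo (-R) R)) :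
    ContDiffOn ℝ n (swing P) (Ioo 0 R) := fun r hr =>
  (contDiffAt_intervalIntegral fun θ _ => (hP.contDiffAt (isOpen_Ioo.mem_nhds
    (mul_sin_mem_Ioo hr θ))).comp (r, θ)
      (f := fun p : ℝ × ℝ => p.1 * sin p.2) (by fun_prop)).contDiffWithinAt

theorem continuous_comp_mul_sin (hP : ContinuousOn P (Ioo (-R) R)) {r : ℝ} (hr : r ∈ Ioo 0 R) :
    Continuous fun θ => P (r * sin θ) :=
  hP.comp_continuous (by fun_prop) (mul_sin_mem_Ioo hr)

theorem continuous_comp_neg_mul_sin (hP : ContinuousOn P (Ioo (-R) R)) {r : ℝ}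
    (hr : r ∈ Ioo 0 R) : Continuous fun θ => P (-(r * sin θ)) := by
  simpa only [Function.comp_def, sin_neg, mul_neg] using
    (continuous_comp_mul_sin hP hr).comp continuous_neg

theorem swing_eq_integral_zero_pi_div_two (hP : ContinuousOn P (Ioo (-R) R)) {r : ℝ}
    (hr : r ∈ Ioo 0 R) :
    swing P r = ∫ θ in (0)..π / 2, (P (r * sin θ) + P (-(r * sin θ))) := by
  have hpos := continuous_comp_mul_sin hP hr
  have hneg := continuous_comp_neg_mul_sin hP hr
  have hreflect : ∫ θ in -(π / 2)..0, P (r * sin θ) = ∫ θ in (0)..π / 2, P (-(r * sin θ)) := by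
    rw [← neg_zero, ← intervalIntegral.integral_comp_neg, neg_zero]
    simp only [sin_neg, mul_neg]
  rw [swing, ← intervalIntegral.integral_add_adjacent_intervals (hpos.intervalIntegrable _ 0)
    (hpos.intervalIntegrable 0 _), hreflect, add_comm, intervalIntegral.integral_add
    (hpos.intervalIntegrable _ _) (hneg.intervalIntegrable _ _)]

theorem strictMonoOn_add_comp_neg (hP : StrictConvexOn ℝ (Ioo (-R) R) P) :
    StrictMonoOn (fun z => P z + P (-z)) (Ico 0 R) := by
  intro z hz w hw hzw
  have hw0 : 0 < w := hz.1.trans_lt hzw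
  have hmem : w ∈ Ioo (-R) R ∧ -w ∈ Ioo (-R) R := by
    refine ⟨⟨?_, ?_⟩, ?_, ?_⟩ <;> linarith [hw.2]
  obtain ⟨t, u, ht, hu, htu, hz'⟩ : ∃ t u : ℝ, 0 < t ∧ 0 < u ∧ t + u = 1 ∧ t * w - u * w = z :=
    ⟨(w + z) / (2 * w), (w - z) / (2 * w), div_pos (by linarith [hz.1]) (by linarith),
      div_pos (by linarith) (by linarith), by field_simp; ring, by field_simp; ring⟩
  have hpos := hP.2 hmem.1 hmem.2 (by linarith) ht hu htu
  have hneg := hP.2 hmem.1 hmem.2 (by linarith) hu ht (by linarith)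
  simp only [smul_eq_mul] at hpos hneg
  rw [show t * w + u * -w = z by linarith] at hpos
  rw [show u * w + t * -w = -z by linarith] at hneg
  change P z + P (-z) < P w + P (-w)
  linear_combination hpos + hneg + (P w + P (-w)) * htu

theorem strictMonoOn_swing (hP : StrictConvexOn ℝ (Ioo (-R) R) P) :
    StrictMonoOn (swing P) (Ioo 0 R) := by
  intro r hr ρ hρ hrρ
  have hcont : ContinuousOn P (Ioo (-R) R) := hP.convexOn.continuousOn isOpen_Ioo
  rw [swing_eq_integral_zero_pi_div_two hcont hr, swing_eq_integral_zero_pi_div_two hcont hρ]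
  refine intervalIntegral_lt_of_continuousOn pi_div_two_pos
    ((continuous_comp_mul_sin hcont hr).add (continuous_comp_neg_mul_sin hcont hr)).continuousOn
    ((continuous_comp_mul_sin hcont hρ).add (continuous_comp_neg_mul_sin hcont hρ)).continuousOn
    fun θ hθ => ?_
  have hsin : 0 < sin θ := sin_pos_of_pos_of_lt_pi hθ.1 (by linarith [hθ.2, pi_pos])
  exact strictMonoOn_add_comp_neg hP ⟨(mul_pos hr.1 hsin).le, (mul_sin_mem_Ioo hr θ).2⟩
    ⟨(mul_pos hρ.1 hsin).le, (mul_sin_mem_Ioo hρ θ).2⟩ (mul_lt_mul_of_pos_right hrρ hsin)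

end Swing

section LogMoment

/-- The moments of the kernel `x / (1 + s * (x - 1))` on `[0, 1]`. The zeroth one is
`x * log x / (x - 1)`, with the removable singularity at `x = 1` removed, and the further ones are
the subsequent Taylor remainders of the logarithm, divided in the same way by powers of `x - 1`. -/
def logMoment (k : ℕ) (x : ℝ) : ℝ :=
  ∫ s in (0)..1, s ^ k * (x / (1 + s * (x - 1)))

variable {x : ℝ} (k : ℕ)

theorem one_add_mul_sub_one_pos {s : ℝ} (hx : 0 < x) (hs : s ∈ Icc (0 : ℝ) 1) :
    0 < 1 + s * (x - 1) := by
  nlinarith [mul_nonneg hs.1 hx.le, hs.1, hs.2]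

theorem contDiffAt_logMoment {n : ℕ∞} (hx : 0 < x) : ContDiffAt ℝ n (logMoment k) x := by
  refine contDiffAt_intervalIntegral fun s hs => ?_
  rw [uIcc_of_le zero_le_one] at hs
  exact (contDiffAt_snd.pow k).mul (contDiffAt_fst.div (by fun_prop)
    (one_add_mul_sub_one_pos hx hs).ne')

theorem continuousOn_logMoment_integrand (hx : 0 < x) :
    ContinuousOn (fun s : ℝ => s ^ k * (x / (1 + s * (x - 1)))) (Icc 0 1) := by
  fun_prop (disch := exact fun s hs => (one_add_mul_sub_one_pos hx hs).ne')

theorem intervalIntegrable_logMoment_integrand (hx : 0 < x) :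
    IntervalIntegrable (fun s : ℝ => s ^ k * (x / (1 + s * (x - 1)))) volume 0 1 :=
  (continuousOn_logMoment_integrand k hx).intervalIntegrable_of_Icc zero_le_one

theorem strictMonoOn_logMoment : StrictMonoOn (logMoment k) (Ioi 0) := by
  intro x hx y hy hxy
  refine intervalIntegral_lt_of_continuousOn zero_lt_one (continuousOn_logMoment_integrand k hx)
    (continuousOn_logMoment_integrand k hy) fun s hs => mul_lt_mul_of_pos_left ?_ (pow_pos hs.1 k)
  rw [div_lt_div_iff₀ (one_add_mul_sub_one_pos hx (Ioo_subset_Icc_self hs))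
    (one_add_mul_sub_one_pos hy (Ioo_subset_Icc_self hs))]
  nlinarith [mul_pos (sub_pos.2 hs.2) (sub_pos.2 hxy)]

theorem logMoment_pos (hx : 0 < x) : 0 < logMoment k x :=
  intervalIntegral.intervalIntegral_pos_of_pos_on (intervalIntegrable_logMoment_integrand k hx)
    (fun _ hs => mul_pos (pow_pos hs.1 k) (div_pos hx
      (one_add_mul_sub_one_pos hx (Ioo_subset_Icc_self hs)))) zero_lt_one

theorem logMoment_one : logMoment k 1 = 1 / (k + 1) := by
  simp [logMoment]

theorem sub_one_mul_logMoment_succ (hx : 0 < x) :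
    (x - 1) * logMoment (k + 1) x = x / (k + 1) - logMoment k x := by
  have hpow : ∫ s : ℝ in (0)..1, x * s ^ k = x / (k + 1) := by simp [div_eq_mul_inv]
  rw [← hpow, logMoment, logMoment, ← intervalIntegral.integral_sub
    ((by fun_prop : Continuous fun s : ℝ => x * s ^ k).intervalIntegrable _ _)
    (intervalIntegrable_logMoment_integrand k hx), ← intervalIntegral.integral_const_mul]
  refine intervalIntegral.integral_congr fun s hs => ?_
  rw [uIcc_of_le zero_le_one] at hs
  linear_combination x * s ^ k * mul_inv_cancel₀ (one_add_mul_sub_one_pos hx hs).ne'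

theorem sub_one_mul_logMoment_zero (hx : 0 < x) : (x - 1) * logMoment 0 x = x * log x := by
  have hderiv : ∀ s ∈ uIcc (0 : ℝ) 1, HasDerivAt (fun s => x * log (1 + s * (x - 1)))
      ((x - 1) * (s ^ 0 * (x / (1 + s * (x - 1))))) s := fun s hs => by
    rw [uIcc_of_le zero_le_one] at hs
    convert! ((((hasDerivAt_id s).mul_const (x - 1)).const_add 1).log
      (one_add_mul_sub_one_pos hx hs).ne').const_mul x using 1
    simp only [id]
    ring
  rw [logMoment, ← intervalIntegral.integral_const_mul,
    intervalIntegral.integral_eq_sub_of_hasDerivAt hderiv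
      ((intervalIntegrable_logMoment_integrand 0 hx).const_mul _)]
  simp

theorem logMoment_zero_inv (hx : 0 < x) : logMoment 0 x⁻¹ = logMoment 0 x / x := by
  rcases eq_or_ne x 1 with rfl | h1
  · simp
  have hinv := sub_one_mul_logMoment_zero (inv_pos.2 hx)
  have hself := sub_one_mul_logMoment_zero hx
  rw [log_inv] at hinv
  rw [eq_div_iff hx.ne']
  refine mul_left_cancel₀ (sub_ne_zero.2 h1) ?_
  linear_combination (-x ^ 2) * hinv - hself +
    x * (logMoment 0 x⁻¹ + log x) * mul_inv_cancel₀ hx.ne'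

end LogMoment

section LogGap

/-- The gap `x - 1 - log x` in the inequality `log x ≤ x - 1`: the potential energy of an even wave
is a multiple of it, with `x` the ratio of `1 - φ ^ 2` to its value at the equilibrium. -/
def logGap (x : ℝ) : ℝ :=
  x - 1 - log x

/-- The speed `√(2 * x * logMoment 1 x)` at which `x` moves when `logGapRoot x` is the time. -/
def logGapSpeed (x : ℝ) : ℝ :=
  √(2 * (x * logMoment 1 x))

/-- The square root of `2 * logGap` that has the sign of `x - 1`; it is smooth at `x = 1`. -/
def logGapRoot (x : ℝ) : ℝ :=
  (1 - x⁻¹) * logGapSpeed x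

variable {x : ℝ}

theorem sub_one_sq_mul_logMoment_one (hx : 0 < x) :
    (x - 1) ^ 2 * logMoment 1 x = x * logGap x := by
  have h0 := sub_one_mul_logMoment_zero hx
  have h1 := sub_one_mul_logMoment_succ 0 hx
  norm_num at h1
  rw [logGap]
  linear_combination (x - 1) * h1 - h0

theorem contDiffAt_mul_logMoment_one {n : ℕ∞} (hx : 0 < x) :
    ContDiffAt ℝ n (fun y => y * logMoment 1 y) x :=
  contDiffAt_id.mul (contDiffAt_logMoment 1 hx)

theorem hasDerivAt_logGap (hx : 0 < x) : HasDerivAt logGap (1 - x⁻¹) x :=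
  ((hasDerivAt_id x).sub_const 1).sub (hasDerivAt_log hx.ne')

theorem sub_one_sq_mul_deriv_mul_logMoment_one (hx : 0 < x) :
    (x - 1) ^ 2 * deriv (fun y => y * logMoment 1 y) x = (x - 1) ^ 2 * (2 * logMoment 2 x) := by
  have hrel : (fun y => (y - 1) ^ 2 * (y * logMoment 1 y)) =ᶠ[𝓝 x]
      fun y => y ^ 2 * logGap y := by
    filter_upwards [lt_mem_nhds hx] with y hy
    linear_combination y * sub_one_sq_mul_logMoment_one hy
  have hleft := (((hasDerivAt_id x).sub_const 1).pow 2).mul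
    ((contDiffAt_mul_logMoment_one (n := 1) hx).differentiableAt one_ne_zero).hasDerivAt
  have hright := ((hasDerivAt_id x).pow 2).mul (hasDerivAt_logGap hx)
  have hderiv := hleft.unique (hright.congr_of_eventuallyEq hrel)
  have hm0 := sub_one_mul_logMoment_zero hx
  have hm1 := sub_one_mul_logMoment_succ 0 hx
  have hm2 := sub_one_mul_logMoment_succ 1 hx
  norm_num [logGap] at hderiv hm1 hm2
  linear_combination hderiv - 2 * (x - 1) * hm2 - 2 * (x - 1) * hm1 + 2 * hm0 -
    x * mul_inv_cancel₀ hx.ne'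

theorem hasDerivAt_mul_logMoment_one (hx : 0 < x) :
    HasDerivAt (fun y => y * logMoment 1 y) (2 * logMoment 2 x) x := by
  have hderiv : ∀ y, 0 < y → y ≠ 1 → deriv (fun y => y * logMoment 1 y) y = 2 * logMoment 2 y :=
    fun y hy hy1 => mul_left_cancel₀ (pow_ne_zero 2 (sub_ne_zero.2 hy1))
      (sub_one_sq_mul_deriv_mul_logMoment_one hy)
  suffices h : deriv (fun y => y * logMoment 1 y) x = 2 * logMoment 2 x by
    rw [← h]
    exact ((contDiffAt_mul_logMoment_one (n := 1) hx).differentiableAt one_ne_zero).hasDerivAt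
  rcases eq_or_ne x 1 with rfl | hx1
  · refine Filter.EventuallyEq.eq_of_nhds (g := fun y => 2 * logMoment 2 y)
      ((ContinuousAt.eventuallyEq_nhds_iff_eventuallyEq_nhdsNE
        ((contDiffAt_mul_logMoment_one (n := 2) hx).derivWithin
          (m := 0) (by norm_num)).continuousAt
        (contDiffAt_const.mul (contDiffAt_logMoment (n := 0) 2 hx)).continuousAt).1 ?_)
    filter_upwards [nhdsWithin_le_nhds (lt_mem_nhds hx), self_mem_nhdsWithin] with y hy hy1
    exact hderiv y hy hy1
  · exact hderiv x hx hx1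

theorem logGapSpeed_pos (hx : 0 < x) : 0 < logGapSpeed x :=
  sqrt_pos.2 (mul_pos two_pos (mul_pos hx (logMoment_pos 1 hx)))

theorem sq_logGapSpeed (hx : 0 < x) : logGapSpeed x ^ 2 = 2 * (x * logMoment 1 x) :=
  sq_sqrt (mul_pos two_pos (mul_pos hx (logMoment_pos 1 hx))).le

theorem contDiffAt_logGapSpeed {n : ℕ∞} (hx : 0 < x) : ContDiffAt ℝ n logGapSpeed x :=
  (contDiffAt_const.mul (contDiffAt_mul_logMoment_one hx)).sqrt
    (mul_pos two_pos (mul_pos hx (logMoment_pos 1 hx))).ne'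

theorem hasDerivAt_logGapSpeed (hx : 0 < x) :
    HasDerivAt logGapSpeed (2 * logMoment 2 x / logGapSpeed x) x := by
  convert! ((hasDerivAt_mul_logMoment_one hx).const_mul 2).sqrt
    (mul_pos two_pos (mul_pos hx (logMoment_pos 1 hx))).ne' using 1
  exact (mul_div_mul_left _ _ two_ne_zero).symm

theorem contDiffAt_logGapRoot {n : ℕ∞} (hx : 0 < x) : ContDiffAt ℝ n logGapRoot x :=
  (contDiffAt_const.sub (contDiffAt_id.inv hx.ne')).mul (contDiffAt_logGapSpeed hx)

theorem sq_logGapRoot (hx : 0 < x) : logGapRoot x ^ 2 = 2 * logGap x := by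
  rw [logGapRoot, mul_pow, sq_logGapSpeed hx]
  field_simp
  linear_combination sub_one_sq_mul_logMoment_one hx

theorem hasDerivAt_logGapRoot (hx : 0 < x) : HasDerivAt logGapRoot (logGapSpeed x)⁻¹ x := by
  convert! ((hasDerivAt_inv hx.ne').const_sub 1).mul (hasDerivAt_logGapSpeed hx) using 1
  have hG := logGapSpeed_pos hx
  have hG2 := sq_logGapSpeed hx
  have hM := sub_one_mul_logMoment_succ 1 hx
  norm_num at hM
  field_simp
  linear_combination -hG2 - 2 * x * hM

theorem strictMonoOn_logGapRoot : StrictMonoOn logGapRoot (Ioi 0) :=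
  strictMonoOn_of_deriv_pos (convex_Ioi 0)
    (fun _ hx => (hasDerivAt_logGapRoot hx).continuousAt.continuousWithinAt) fun x hx => by
      rw [interior_Ioi] at hx
      rw [(hasDerivAt_logGapRoot hx).deriv]
      exact inv_pos.2 (logGapSpeed_pos hx)

theorem logGapRoot_one : logGapRoot 1 = 0 := by
  simp [logGapRoot]

theorem sq_sqrt_sub_one_le_logGap (hx : 0 < x) : (√x - 1) ^ 2 ≤ logGap x := by
  have hlog := log_le_sub_one_of_pos (sqrt_pos.2 hx)
  rw [log_sqrt hx.le] at hlog
  rw [logGap]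
  linarith [sq_sqrt hx.le]

theorem le_logGapRoot_one_add_sq {c : ℝ} (hc : 0 ≤ c) : c ≤ logGapRoot ((1 + c) ^ 2) := by
  have hx : 0 < (1 + c) ^ 2 := by positivity
  have hroot : 0 ≤ logGapRoot ((1 + c) ^ 2) := by
    rw [← logGapRoot_one]
    exact strictMonoOn_logGapRoot.monotoneOn (mem_Ioi.2 one_pos) hx (by nlinarith)
  have hgap := sq_sqrt_sub_one_le_logGap hx
  rw [sqrt_sq (by linarith)] at hgap
  exact abs_le_of_sq_le_sq' (by nlinarith [sq_logGapRoot hx]) hroot |>.2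

theorem logGapRoot_exp_le_neg {c : ℝ} (hc : 0 ≤ c) : logGapRoot (exp (-1 - c ^ 2)) ≤ -c := by
  have hx := exp_pos (-1 - c ^ 2)
  have hroot : logGapRoot (exp (-1 - c ^ 2)) ≤ 0 := by
    rw [← logGapRoot_one]
    exact strictMonoOn_logGapRoot.monotoneOn hx (mem_Ioi.2 one_pos)
      (exp_le_one_iff.2 (by nlinarith))
  have hgap := sq_logGapRoot hx
  rw [logGap, log_exp] at hgap
  nlinarith

theorem surjOn_logGapRoot : SurjOn logGapRoot (Ioi 0) univ := by
  intro z _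
  have himage : OrdConnected (logGapRoot '' Ioi 0) :=
    (isPreconnected_Ioi.image _ fun _ hx =>
      (hasDerivAt_logGapRoot hx).continuousAt.continuousWithinAt).ordConnected
  exact himage.out (mem_image_of_mem _ (exp_pos (-1 - |z| ^ 2)))
    (mem_image_of_mem _ (show 0 < (1 + |z|) ^ 2 by positivity))
    ⟨(logGapRoot_exp_le_neg (abs_nonneg z)).trans (neg_abs_le z),
      (le_abs_self z).trans (le_logGapRoot_one_add_sq (abs_nonneg z))⟩

/-- The inverse of the bijection `logGapRoot` from the positive reals onto the reals. -/
def logGapRootInv : ℝ → ℝ :=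
  Function.invFunOn logGapRoot (Ioi 0)

theorem logGapRootInv_pos (z : ℝ) : 0 < logGapRootInv z :=
  Function.invFunOn_mem (surjOn_logGapRoot (mem_univ z))

theorem logGapRoot_logGapRootInv (z : ℝ) : logGapRoot (logGapRootInv z) = z :=
  Function.invFunOn_eq (surjOn_logGapRoot (mem_univ z))

theorem logGapRootInv_logGapRoot (hx : 0 < x) : logGapRootInv (logGapRoot x) = x :=
  strictMonoOn_logGapRoot.injOn.leftInvOn_invFunOn hx

theorem strictMono_logGapRootInv : StrictMono logGapRootInv := fun z w hzw => by
  rwa [← strictMonoOn_logGapRoot.lt_iff_lt (logGapRootInv_pos z) (logGapRootInv_pos w),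
    logGapRoot_logGapRootInv, logGapRoot_logGapRootInv]

theorem contDiff_logGapRootInv {n : ℕ∞} : ContDiff ℝ n logGapRootInv := by
  refine contDiff_iff_contDiffAt.2 fun z => ?_
  have hx := logGapRootInv_pos z
  have hinv : ContDiffAt ℝ (⊤ : ℕ∞) logGapRootInv (logGapRoot (logGapRootInv z)) :=
    contDiffAt_of_eventually_leftInverse (by simp) (contDiffAt_logGapRoot hx)
      (hasDerivAt_logGapRoot hx) (inv_ne_zero (logGapSpeed_pos hx).ne')
      ((lt_mem_nhds hx).mono fun _ => logGapRootInv_logGapRoot)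
  rw [logGapRoot_logGapRootInv] at hinv
  exact hinv.of_le (mod_cast le_top)

theorem hasDerivAt_logGapRootInv (z : ℝ) :
    HasDerivAt logGapRootInv (logGapSpeed (logGapRootInv z)) z := by
  simpa only [inv_inv] using HasDerivAt.of_local_left_inverse
    (contDiff_logGapRootInv (n := 0)).continuous.continuousAt
    (hasDerivAt_logGapRoot (logGapRootInv_pos z))
    (inv_ne_zero (logGapSpeed_pos (logGapRootInv_pos z)).ne')
    (Eventually.of_forall logGapRoot_logGapRootInv)

end LogGap

section EvenDensity

/-- The position of the even wave at which `logGapRoot` of `(1 - φ ^ 2) / a` takes the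
value `z`. -/
def evenPosition (a z : ℝ) : ℝ :=
  √(1 - a * logGapRootInv z)

/-- The rate at which `evenPosition a` decreases, divided by `a / 2`. -/
def evenDensity (a z : ℝ) : ℝ :=
  logGapSpeed (logGapRootInv z) / evenPosition a z

variable {a z : ℝ}

theorem mul_logGapRootInv_lt_one (ha : 0 < a) (hz : z < logGapRoot a⁻¹) :
    a * logGapRootInv z < 1 := by
  have hlt := strictMono_logGapRootInv hz
  rwa [logGapRootInv_logGapRoot (inv_pos.2 ha), lt_inv_comm₀ (logGapRootInv_pos z) ha,
    ← one_div, lt_div_iff₀ (logGapRootInv_pos z)] at hlt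

theorem evenPosition_pos (ha : 0 < a) (hz : z < logGapRoot a⁻¹) : 0 < evenPosition a z :=
  sqrt_pos.2 (sub_pos.2 (mul_logGapRootInv_lt_one ha hz))

theorem sq_evenPosition (ha : 0 < a) (hz : z < logGapRoot a⁻¹) :
    evenPosition a z ^ 2 = 1 - a * logGapRootInv z :=
  sq_sqrt (sub_pos.2 (mul_logGapRootInv_lt_one ha hz)).le

theorem hasDerivAt_evenPosition (ha : 0 < a) (hz : z < logGapRoot a⁻¹) :
    HasDerivAt (evenPosition a) (-(a / 2 * evenDensity a z)) z := by
  convert! (((hasDerivAt_logGapRootInv z).const_mul a).const_sub 1).sqrt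
    (sub_pos.2 (mul_logGapRootInv_lt_one ha hz)).ne' using 1
  rw [evenDensity, evenPosition]
  ring

theorem strictAntiOn_evenPosition (ha : 0 < a) :
    StrictAntiOn (evenPosition a) (Iio (logGapRoot a⁻¹)) := fun _ _ _ hw hzw =>
  sqrt_lt_sqrt (sub_pos.2 (mul_logGapRootInv_lt_one ha hw)).le
    (sub_lt_sub_left (mul_lt_mul_of_pos_left (strictMono_logGapRootInv hzw) ha) 1)

theorem evenDensity_pos (ha : 0 < a) (hz : z < logGapRoot a⁻¹) : 0 < evenDensity a z :=
  div_pos (logGapSpeed_pos (logGapRootInv_pos z)) (evenPosition_pos ha hz)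

theorem contDiffOn_evenDensity (ha : 0 < a) {n : ℕ∞} :
    ContDiffOn ℝ n (evenDensity a) (Iio (logGapRoot a⁻¹)) := fun z hz =>
  (((contDiffAt_logGapSpeed (logGapRootInv_pos z)).comp z contDiff_logGapRootInv.contDiffAt).div
    ((contDiffAt_const.sub (contDiffAt_const.mul contDiff_logGapRootInv.contDiffAt)).sqrt
      (sub_pos.2 (mul_logGapRootInv_lt_one ha hz)).ne')
    (evenPosition_pos ha hz).ne').contDiffWithinAt

/-- The derivative of `evenDensity a` at `z`, as a function of `logGapRootInv z`. -/
def evenDensitySlope (a x : ℝ) : ℝ :=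
  (2 * logMoment 2 x + a * (x * logMoment 1 x) / (1 - a * x)) / √(1 - a * x)

theorem hasDerivAt_evenDensity (ha : 0 < a) (hz : z < logGapRoot a⁻¹) :
    HasDerivAt (evenDensity a) (evenDensitySlope a (logGapRootInv z)) z := by
  have hx := logGapRootInv_pos z
  have hspeed := logGapSpeed_pos hx
  have hspeed2 := sq_logGapSpeed hx
  have hpos := evenPosition_pos ha hz
  convert! ((hasDerivAt_logGapSpeed hx).comp z (hasDerivAt_logGapRootInv z)).div
    (hasDerivAt_evenPosition ha hz) hpos.ne' using 1
  rw [evenDensitySlope, ← sq_evenPosition ha hz, sqrt_sq hpos.le, evenDensity]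
  simp only [Function.comp_apply]
  field_simp
  linear_combination -a * hspeed2

theorem strictMonoOn_evenDensitySlope (ha : 0 < a) :
    StrictMonoOn (evenDensitySlope a) (Ioo 0 a⁻¹) := by
  intro x ⟨hx, _⟩ y ⟨hy, hya⟩ hxy
  have hay : 0 < 1 - a * y := by
    rwa [sub_pos, ← lt_inv_mul_iff₀ ha, mul_one]
  have hyM := mul_pos hy (logMoment_pos 1 hy)
  have hM : x * logMoment 1 x < y * logMoment 1 y :=
    mul_lt_mul'' hxy (strictMonoOn_logMoment 1 hx hy hxy) hx.le (logMoment_pos 1 hx).le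
  have hM2 : logMoment 2 x < logMoment 2 y := strictMonoOn_logMoment 2 hx hy hxy
  have hM2pos := logMoment_pos 2 hy
  have := sqrt_pos.2 hay
  unfold evenDensitySlope
  gcongr

theorem strictConvexOn_evenDensity (ha : 0 < a) :
    StrictConvexOn ℝ (Iio (logGapRoot a⁻¹)) (evenDensity a) := by
  refine StrictMonoOn.strictConvexOn_of_deriv (convex_Iio _)
    (contDiffOn_evenDensity (n := 0) ha).continuousOn ?_
  rw [interior_Iio]
  have hmaps : MapsTo logGapRootInv (Iio (logGapRoot a⁻¹)) (Ioo 0 a⁻¹) := fun z hz =>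
    ⟨logGapRootInv_pos z, by
      simpa only [logGapRootInv_logGapRoot (inv_pos.2 ha)] using strictMono_logGapRootInv hz⟩
  exact ((strictMonoOn_evenDensitySlope ha).comp
    (strictMono_logGapRootInv.strictMonoOn _) hmaps).congr fun z hz =>
      (hasDerivAt_evenDensity ha hz).deriv.symm

end EvenDensity

section EvenWave

variable {ω 𝓔 φ : ℝ}

theorem mem_orbitRange : φ ∈ orbitRange ω 𝓔 ↔
    φ ∈ Ioo (-1) 1 ∧ potential ω φ ≤ 𝓔 ∧ (𝓔 < criticalEnergy ω → 0 < φ) := by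
  constructor
  · rintro ⟨⟨φ, ξ⟩, ⟨h₁, h₂, henergy, hpos⟩, rfl⟩
    refine ⟨⟨h₁, h₂⟩, ?_, hpos⟩
    rw [← henergy, energy]
    linarith [sq_nonneg ξ]
  · rintro ⟨⟨h₁, h₂⟩, hle, hpos⟩
    refine ⟨(φ, √(2 * (𝓔 - potential ω φ))), ⟨h₁, h₂, ?_, hpos⟩, rfl⟩
    rw [energy, sq_sqrt (by linarith)]
    ring

theorem potential_eq_logGap (hω : ω < 1) :
    potential ω φ = (1 - ω) / 2 * logGap ((1 - φ ^ 2) / (1 - ω)) := by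
  have ha : 1 - ω ≠ 0 := (sub_pos.2 hω).ne'
  rw [potential, logGap, ← inv_div (1 - φ ^ 2), log_inv]
  field_simp
  ring

theorem criticalEnergy_eq_potential : criticalEnergy ω = potential ω 0 := by
  simp [criticalEnergy, energy]

theorem criticalEnergy_eq_sq_logGapRoot (hω : ω < 1) :
    criticalEnergy ω = (1 - ω) / 4 * logGapRoot (1 - ω)⁻¹ ^ 2 := by
  rw [criticalEnergy_eq_potential, potential_eq_logGap hω,
    sq_logGapRoot (inv_pos.2 (sub_pos.2 hω)), zero_pow two_ne_zero, sub_zero, one_div]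
  ring

theorem potential_evenPosition {z : ℝ} (hω : ω < 1) (hz : z < logGapRoot (1 - ω)⁻¹) :
    potential ω (evenPosition (1 - ω) z) = (1 - ω) / 4 * z ^ 2 := by
  have ha := sub_pos.2 hω
  have hgap := sq_logGapRoot (logGapRootInv_pos z)
  rw [logGapRoot_logGapRootInv] at hgap
  rw [potential_eq_logGap hω, sq_evenPosition ha hz, sub_sub_cancel, mul_div_cancel_left₀ _ ha.ne',
    hgap]
  ring

theorem image_mul_sin {r : ℝ} (hr : 0 < r) :
    (fun θ => r * sin θ) '' Icc (-(π / 2)) (π / 2) = Icc (-r) r := by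
  rw [← image_image (r * ·) sin, bijOn_sin.image_eq, image_mul_left_Icc hr.le (by norm_num),
    mul_neg, mul_one]

variable {r : ℝ}

theorem orbitRange_even (hω : ω < 1) (hr : r ∈ Ioo 0 (logGapRoot (1 - ω)⁻¹)) :
    orbitRange ω ((1 - ω) / 4 * r ^ 2) = evenPosition (1 - ω) '' Icc (-r) r := by
  have ha : 0 < 1 - ω := sub_pos.2 hω
  have hcrit : (1 - ω) / 4 * r ^ 2 < criticalEnergy ω := by
    rw [criticalEnergy_eq_sq_logGapRoot hω]
    exact mul_lt_mul_of_pos_left (pow_lt_pow_left₀ hr.2 hr.1.le two_ne_zero) (by positivity)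
  ext φ
  rw [mem_orbitRange]
  constructor
  · rintro ⟨hφ, hle, hpos⟩
    have hφ0 := hpos hcrit
    have hx : 0 < (1 - φ ^ 2) / (1 - ω) := div_pos (by nlinarith [hφ.2]) ha
    refine ⟨logGapRoot ((1 - φ ^ 2) / (1 - ω)), ?_, ?_⟩
    · rw [mem_Icc, ← abs_le, ← sq_le_sq₀ (abs_nonneg _) hr.1.le, sq_abs, sq_logGapRoot hx]
      rw [potential_eq_logGap hω] at hle
      nlinarith
    · rw [evenPosition, logGapRootInv_logGapRoot hx, mul_div_cancel₀ _ ha.ne', sub_sub_cancel,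
        sqrt_sq hφ0.le]
  · rintro ⟨z, hz, rfl⟩
    have hzZ := hz.2.trans_lt hr.2
    have hpos := evenPosition_pos ha hzZ
    have hsq := sq_evenPosition ha hzZ
    have hX := mul_pos ha (logGapRootInv_pos z)
    refine ⟨⟨by linarith, by nlinarith⟩, ?_, fun _ => hpos⟩
    rw [potential_evenPosition hω hzZ]
    exact mul_le_mul_of_nonneg_left (sq_le_sq' hz.1 hz.2) (by positivity)

theorem periodIntegrand_evenPosition (hω : ω < 1) (hr : r ∈ Ioo 0 (logGapRoot (1 - ω)⁻¹))
    {θ : ℝ} (hθ : θ ∈ Ioo (-(π / 2)) (π / 2)) :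
    |-((1 - ω) / 2 * evenDensity (1 - ω) (r * sin θ)) * (r * cos θ)| *
      periodIntegrand ω ((1 - ω) / 4 * r ^ 2) (evenPosition (1 - ω) (r * sin θ)) =
      √((1 - ω) / 2) * evenDensity (1 - ω) (r * sin θ) := by
  have ha : 0 < 1 - ω := sub_pos.2 hω
  have hz := (mul_sin_mem_Ioo hr θ).2
  have hspeed : 0 < r * cos θ := mul_pos hr.1 (cos_pos_of_mem_Ioo hθ)
  have hkinetic : 2 * ((1 - ω) / 4 * r ^ 2 - (1 - ω) / 4 * (r * sin θ) ^ 2) =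
      (1 - ω) / 2 * (r * cos θ) ^ 2 := by
    linear_combination -(1 - ω) / 2 * r ^ 2 * cos_sq_add_sin_sq θ
  have := sqrt_pos.2 (half_pos ha)
  rw [periodIntegrand, potential_evenPosition hω hz, hkinetic, sqrt_mul (half_pos ha).le,
    sqrt_sq hspeed.le, neg_mul, abs_neg,
    abs_of_pos (mul_pos (mul_pos (half_pos ha) (evenDensity_pos ha hz)) hspeed)]
  generalize r * cos θ = v at hspeed ⊢
  field_simp
  rw [sq_sqrt (half_pos ha).le]
  ring

theorem integral_orbitRange_even (hω : ω < 1) (hr : r ∈ Ioo 0 (logGapRoot (1 - ω)⁻¹)) :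
    IntegrableOn (periodIntegrand ω ((1 - ω) / 4 * r ^ 2))
        (orbitRange ω ((1 - ω) / 4 * r ^ 2)) ∧
      ∫ φ in orbitRange ω ((1 - ω) / 4 * r ^ 2), periodIntegrand ω ((1 - ω) / 4 * r ^ 2) φ =
        √((1 - ω) / 2) * swing (evenDensity (1 - ω)) r := by
  have ha : 0 < 1 - ω := sub_pos.2 hω
  have hderiv : ∀ θ, HasDerivAt (fun θ => evenPosition (1 - ω) (r * sin θ))
      (-((1 - ω) / 2 * evenDensity (1 - ω) (r * sin θ)) * (r * cos θ)) θ := fun θ =>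
    HasDerivAt.comp (h₂ := evenPosition (1 - ω)) θ
      (hasDerivAt_evenPosition ha (mul_sin_mem_Ioo hr θ).2) ((hasDerivAt_sin θ).const_mul r)
  rw [orbitRange_even hω hr, ← image_mul_sin hr.1, image_image, swing,
    ← intervalIntegral.integral_const_mul]
  refine integral_image_Icc (by linarith [pi_pos]) (fun θ _ => hderiv θ) ?_
    (continuous_const.mul (continuous_comp_mul_sin
      ((contDiffOn_evenDensity (n := 0) ha).continuousOn.mono Ioo_subset_Iio_self) hr)).continuousOn
    fun θ hθ => periodIntegrand_evenPosition hω hr hθ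
  exact (strictAntiOn_evenPosition ha).injOn.comp
    (((mul_right_injective₀ hr.1.ne').injOn).comp injOn_sin (mapsTo_univ _ _))
    fun θ _ => (mul_sin_mem_Ioo hr θ).2

/-- The amplitude `r` of the even wave of energy `𝓔`, measured in the coordinate in which the
potential energy is `(1 - ω) / 4 * z ^ 2`. -/
def evenAmplitude (ω 𝓔 : ℝ) : ℝ :=
  √(4 / (1 - ω) * 𝓔)

theorem sq_evenAmplitude (hω : ω < 1) (h𝓔 : 0 ≤ 𝓔) :
    (1 - ω) / 4 * evenAmplitude ω 𝓔 ^ 2 = 𝓔 := by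
  have ha : 0 < 1 - ω := sub_pos.2 hω
  rw [evenAmplitude, sq_sqrt (by positivity)]
  field_simp

theorem mapsTo_evenAmplitude (h0 : 0 < ω) (hω : ω < 1) :
    MapsTo (evenAmplitude ω) (Ioo 0 (criticalEnergy ω)) (Ioo 0 (logGapRoot (1 - ω)⁻¹)) := by
  intro 𝓔 h𝓔
  have ha : 0 < 1 - ω := sub_pos.2 hω
  have hroot : 0 < logGapRoot (1 - ω)⁻¹ := by
    rw [← logGapRoot_one]
    exact strictMonoOn_logGapRoot (mem_Ioi.2 one_pos) (inv_pos.2 ha)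
      ((one_lt_inv₀ ha).2 (by linarith))
  refine ⟨sqrt_pos.2 (mul_pos (by positivity) h𝓔.1), ?_⟩
  rw [evenAmplitude, sqrt_lt' hroot, div_mul_eq_mul_div, div_lt_iff₀ ha]
  have := h𝓔.2
  rw [criticalEnergy_eq_sq_logGapRoot hω] at this
  linarith

theorem integrableOn_periodIntegrand_even (h0 : 0 < ω) (hω : ω < 1)
    (h𝓔 : 𝓔 ∈ Ioo 0 (criticalEnergy ω)) :
    IntegrableOn (periodIntegrand ω 𝓔) (orbitRange ω 𝓔) := by
  have h := (integral_orbitRange_even hω (mapsTo_evenAmplitude h0 hω h𝓔)).1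
  rwa [sq_evenAmplitude hω h𝓔.1.le] at h

theorem period_even (h0 : 0 < ω) (hω : ω < 1) (h𝓔 : 𝓔 ∈ Ioo 0 (criticalEnergy ω)) :
    period 𝓔 ω = 2 * (√((1 - ω) / 2) * swing (evenDensity (1 - ω)) (evenAmplitude ω 𝓔)) := by
  have h := (integral_orbitRange_even hω (mapsTo_evenAmplitude h0 hω h𝓔)).2
  rw [sq_evenAmplitude hω h𝓔.1.le] at h
  rw [period, h]

theorem contDiffOn_period_even (h0 : 0 < ω) (hω : ω < 1) {n : ℕ∞} :
    ContDiffOn ℝ n (fun 𝓔 => period 𝓔 ω) (Ioo 0 (criticalEnergy ω)) := by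
  have ha : 0 < 1 - ω := sub_pos.2 hω
  have hamplitude : ContDiffOn ℝ n (evenAmplitude ω) (Ioo 0 (criticalEnergy ω)) :=
    (contDiffOn_const.mul contDiffOn_id).sqrt fun _ h𝓔 =>
      (mul_pos (by positivity) h𝓔.1).ne'
  exact (contDiffOn_const.mul (contDiffOn_const.mul
    ((contDiffOn_swing ((contDiffOn_evenDensity ha).mono Ioo_subset_Iio_self)).comp hamplitude
      (mapsTo_evenAmplitude h0 hω)))).congr fun _ h𝓔 => period_even h0 hω h𝓔

theorem strictMonoOn_period_even (h0 : 0 < ω) (hω : ω < 1) :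
    StrictMonoOn (fun 𝓔 => period 𝓔 ω) (Ioo 0 (criticalEnergy ω)) := by
  intro 𝓔 h𝓔 𝓕 h𝓕 hlt
  have ha : 0 < 1 - ω := sub_pos.2 hω
  have hamplitude : evenAmplitude ω 𝓔 < evenAmplitude ω 𝓕 :=
    sqrt_lt_sqrt (mul_pos (by positivity) h𝓔.1).le (mul_lt_mul_of_pos_left hlt (by positivity))
  have hswing := strictMonoOn_swing
    ((strictConvexOn_evenDensity ha).subset Ioo_subset_Iio_self (convex_Ioo _ _))
    (mapsTo_evenAmplitude h0 hω h𝓔) (mapsTo_evenAmplitude h0 hω h𝓕) hamplitude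
  change period 𝓔 ω < period 𝓕 ω
  rw [period_even h0 hω h𝓔, period_even h0 hω h𝓕]
  gcongr

end EvenWave

section OddDrop

/-- The drop of `s ↦ oddEnergy (1 - a) s` from `s` to `τ * s`, divided by `s * (1 - τ) / 2`; it
extends smoothly to `τ = 1`. -/
def oddDrop (a s τ : ℝ) : ℝ :=
  a / (1 - s) * logMoment 0 ((1 - s) / (1 - τ * s)) - 1

variable {a s τ : ℝ}

theorem one_sub_mul_pos (hs : s < 1) (hτ : τ ∈ Icc 0 1) : 0 < 1 - τ * s := by
  nlinarith [mul_nonneg hτ.1 (sub_pos.2 hs).le, hτ.2]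

theorem contDiffAt_oddDrop (hs : s < 1) (hτ : τ ∈ Icc 0 1) {n : ℕ∞} :
    ContDiffAt ℝ n (Function.uncurry (oddDrop a)) (s, τ) := by
  have hs' := sub_pos.2 hs
  have hτs := one_sub_mul_pos hs hτ
  have hratio : ContDiffAt ℝ n (fun p : ℝ × ℝ => (1 - p.1) / (1 - p.2 * p.1)) (s, τ) :=
    (contDiffAt_const.sub contDiffAt_fst).div (by fun_prop) hτs.ne'
  exact ((contDiffAt_const.div (contDiffAt_const.sub contDiffAt_fst) hs'.ne').mul
    ((contDiffAt_logMoment 0 (div_pos hs' hτs)).comp (s, τ) hratio)).sub contDiffAt_const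

theorem oddDrop_eq_inv (hs : s < 1) (hτ : τ ∈ Icc 0 1) :
    oddDrop a s τ = a / (1 - τ * s) * logMoment 0 ((1 - τ * s) / (1 - s)) - 1 := by
  have hs' := sub_pos.2 hs
  have hτs := one_sub_mul_pos hs hτ
  rw [oddDrop, ← inv_div (1 - τ * s), logMoment_zero_inv (div_pos hτs hs')]
  field_simp

theorem strictMonoOn_oddDrop (ha : 0 < a) (hτ : τ ∈ Ico 0 1) :
    StrictMonoOn (fun s => oddDrop a s τ) (Iio 1) := by
  intro s hs t ht hst
  have hτ' := Ico_subset_Icc_self hτ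
  have hτs := one_sub_mul_pos hs hτ'
  have hτt := one_sub_mul_pos ht hτ'
  have hs' : 0 < 1 - s := sub_pos.2 hs
  have ht' : 0 < 1 - t := sub_pos.2 ht
  have hratio : (1 - τ * s) / (1 - s) < (1 - τ * t) / (1 - t) := by
    rw [div_lt_div_iff₀ hs' ht']
    nlinarith [mul_pos (sub_pos.2 hτ.2) (sub_pos.2 hst)]
  have hmoment := strictMonoOn_logMoment 0 (mem_Ioi.2 (div_pos hτs hs')) (div_pos hτt ht') hratio
  have hpos := logMoment_pos 0 (div_pos hτs hs')
  simp only [oddDrop_eq_inv hs hτ', oddDrop_eq_inv ht hτ']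
  have hcoef : a / (1 - τ * s) ≤ a / (1 - τ * t) :=
    div_le_div_of_nonneg_left ha.le hτt (by nlinarith [hτ.1])
  exact sub_lt_sub_right (mul_lt_mul' hcoef hmoment hpos.le (div_pos ha hτt)) 1

theorem monotoneOn_oddDrop (ha : 0 < a) (hs : s ∈ Ioo 0 1) :
    MonotoneOn (oddDrop a s) (Icc 0 1) := by
  intro τ hτ υ hυ hle
  have hs' : 0 < 1 - s := sub_pos.2 hs.2
  have hυs := one_sub_mul_pos hs.2 hυ
  have hratio : (1 - s) / (1 - τ * s) ≤ (1 - s) / (1 - υ * s) :=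
    div_le_div_of_nonneg_left hs'.le hυs (by nlinarith [hs.1])
  exact sub_le_sub_right (mul_le_mul_of_nonneg_left ((strictMonoOn_logMoment 0).monotoneOn
    (div_pos hs' (one_sub_mul_pos hs.2 hτ)) (div_pos hs' hυs) hratio) (div_pos ha hs').le) 1

theorem oddDrop_one (hs : s < 1) : oddDrop a s 1 = a / (1 - s) - 1 := by
  simp [oddDrop, div_self (sub_pos.2 hs).ne', logMoment_one]

end OddDrop

section OddWave

/-- The energy of the odd wave of amplitude `√s`. -/
def oddEnergy (ω s : ℝ) : ℝ :=
  (ω - s) / 2 + (1 - ω) / 2 * log ((1 - ω) / (1 - s))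

/-- The squares of the amplitudes of the odd waves. -/
def oddAmplitudes (ω : ℝ) : Set ℝ :=
  {s ∈ Ioo 0 1 | criticalEnergy ω < oddEnergy ω s}

variable {ω s τ 𝓔 : ℝ}

theorem potential_eq_oddEnergy (ω φ : ℝ) : potential ω φ = oddEnergy ω (φ ^ 2) := by
  rw [potential, oddEnergy]
  ring

theorem criticalEnergy_eq_oddEnergy_zero (ω : ℝ) : criticalEnergy ω = oddEnergy ω 0 := by
  rw [criticalEnergy_eq_potential, potential_eq_oddEnergy, zero_pow two_ne_zero]

theorem hasDerivAt_oddEnergy (hω : ω < 1) (hs : s < 1) :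
    HasDerivAt (oddEnergy ω) (oddDrop (1 - ω) s 1 / 2) s := by
  have ha := (sub_pos.2 hω).ne'
  have hs' := (sub_pos.2 hs).ne'
  convert! (((hasDerivAt_id s).const_sub ω).div_const 2).add (((((hasDerivAt_id s).const_sub
    1).inv hs').const_mul (1 - ω)).log (mul_ne_zero ha (inv_ne_zero hs')) |>.const_mul
      ((1 - ω) / 2)) using 1
  rw [oddDrop_one hs]
  simp only [id, Pi.inv_apply]
  field_simp
  ring

theorem contDiffAt_oddEnergy (hω : ω < 1) (hs : s < 1) {n : ℕ∞} :
    ContDiffAt ℝ n (oddEnergy ω) s := by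
  have hlog := (div_pos (sub_pos.2 hω) (sub_pos.2 hs)).ne'
  have hs' := (sub_pos.2 hs).ne'
  unfold oddEnergy
  fun_prop (disch := assumption)

theorem oddEnergy_sub_oddEnergy_mul (hω : ω < 1) (hs : s < 1) (hτ : τ ∈ Icc 0 1) :
    2 * (oddEnergy ω s - oddEnergy ω (τ * s)) = s * (1 - τ) * oddDrop (1 - ω) s τ := by
  have ha := sub_pos.2 hω
  have hs' := sub_pos.2 hs
  have hτs := one_sub_mul_pos hs hτ
  have hlog := sub_one_mul_logMoment_zero (div_pos hs' hτs)
  rw [log_div hs'.ne' hτs.ne', div_sub_one hτs.ne', div_mul_eq_mul_div, div_mul_eq_mul_div,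
    div_left_inj' hτs.ne'] at hlog
  rw [oddEnergy, oddEnergy, oddDrop, log_div ha.ne' hs'.ne', log_div ha.ne' hτs.ne']
  generalize logMoment 0 ((1 - s) / (1 - τ * s)) = M at hlog ⊢
  generalize log (1 - τ * s) = L at hlog ⊢
  field_simp
  linear_combination (1 - ω) * hlog

theorem oddDrop_pos (hω : ω < 1) (hs : s ∈ oddAmplitudes ω) (hτ : τ ∈ Icc 0 1) :
    0 < oddDrop (1 - ω) s τ := by
  have h0 : (0 : ℝ) ∈ Icc 0 1 := left_mem_Icc.2 zero_le_one
  refine lt_of_lt_of_le ?_ (monotoneOn_oddDrop (sub_pos.2 hω) hs.1 h0 hτ hτ.1)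
  have hdrop := oddEnergy_sub_oddEnergy_mul hω hs.1.2 h0
  rw [zero_mul, ← criticalEnergy_eq_oddEnergy_zero, sub_zero, mul_one] at hdrop
  exact pos_of_mul_pos_right (hdrop ▸ mul_pos two_pos (sub_pos.2 hs.2)) hs.1.1.le

theorem isOpen_oddAmplitudes (hω : ω < 1) : IsOpen (oddAmplitudes ω) :=
  ContinuousOn.isOpen_inter_preimage (fun _ hs =>
    (hasDerivAt_oddEnergy hω hs.2).continuousAt.continuousWithinAt) isOpen_Ioo isOpen_Ioi

theorem oddEnergy_lt_of_oddDrop_pos {t : ℝ} (hω : ω < 1) (hs : 0 ≤ s) (hst : s < t) (ht : t < 1)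
    (hdrop : 0 < oddDrop (1 - ω) t (s / t)) : oddEnergy ω s < oddEnergy ω t := by
  have ht0 := hs.trans_lt hst
  have hratio : s / t < 1 := (div_lt_one ht0).2 hst
  have hsub := oddEnergy_sub_oddEnergy_mul hω ht ⟨div_nonneg hs ht0.le, hratio.le⟩
  rw [div_mul_cancel₀ _ ht0.ne'] at hsub
  linarith [mul_pos (mul_pos ht0 (sub_pos.2 hratio)) hdrop]

theorem oddEnergy_le_oddEnergy_iff {t : ℝ} (hω : ω < 1) (hs : s ∈ oddAmplitudes ω)
    (ht : t ∈ Ico 0 1) : oddEnergy ω t ≤ oddEnergy ω s ↔ t ≤ s := by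
  constructor
  · contrapose!
    intro hst
    have hτ : s / t ∈ Ico 0 1 := ⟨div_nonneg hs.1.1.le ht.1, (div_lt_one (hs.1.1.trans hst)).2 hst⟩
    exact oddEnergy_lt_of_oddDrop_pos hω hs.1.1.le hst ht.2
      ((oddDrop_pos hω hs (Ico_subset_Icc_self hτ)).trans
        (strictMonoOn_oddDrop (sub_pos.2 hω) hτ hs.1.2 ht.2 hst))
  · intro hts
    rcases hts.eq_or_lt with rfl | hts
    · exact le_rfl
    · exact (oddEnergy_lt_of_oddDrop_pos hω ht.1 hts hs.1.2 (oddDrop_pos hω hs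
        ⟨div_nonneg ht.1 hs.1.1.le, div_le_one_of_le₀ hts.le hs.1.1.le⟩)).le

theorem strictMonoOn_oddEnergy (hω : ω < 1) : StrictMonoOn (oddEnergy ω) (oddAmplitudes ω) :=
  fun _ hs _ ht hst => lt_of_not_ge fun hle =>
    hst.not_ge ((oddEnergy_le_oddEnergy_iff hω hs (Ioo_subset_Ico_self ht.1)).1 hle)

theorem surjOn_oddEnergy (hω : ω < 1) :
    SurjOn (oddEnergy ω) (oddAmplitudes ω) (Ioi (criticalEnergy ω)) := by
  intro 𝓔 h𝓔
  have ha : 0 < 1 - ω := sub_pos.2 hω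
  obtain ⟨c, hc⟩ : ∃ c, (1 - ω) / 2 * c = 𝓔 - criticalEnergy ω + 1 / 2 :=
    ⟨_, mul_div_cancel₀ _ (half_pos ha).ne'⟩
  have hc0 : 0 < c := pos_of_mul_pos_right
    (hc ▸ add_pos (sub_pos.2 (mem_Ioi.1 h𝓔)) one_half_pos) (half_pos ha).le
  have hexp : exp (-c) < 1 := exp_lt_one_iff.2 (neg_lt_zero.2 hc0)
  have hcont : ContinuousOn (oddEnergy ω) (Icc 0 (1 - exp (-c))) := fun s hs =>
    (hasDerivAt_oddEnergy hω (hs.2.trans_lt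
      (sub_lt_self 1 (exp_pos _)))).continuousAt.continuousWithinAt
  have hzero := criticalEnergy_eq_oddEnergy_zero ω
  have hlarge : 𝓔 ≤ oddEnergy ω (1 - exp (-c)) := by
    simp only [oddEnergy, sub_zero, div_one] at hzero
    rw [oddEnergy, sub_sub_cancel, log_div ha.ne' (exp_pos _).ne', log_exp]
    linarith [exp_pos (-c)]
  obtain ⟨s, hs, rfl⟩ := intermediate_value_Icc (sub_pos.2 hexp).le hcont
    ⟨(hzero ▸ mem_Ioi.1 h𝓔).le, hlarge⟩
  have hs0 : s ≠ 0 := by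
    rintro rfl
    exact h𝓔.ne hzero
  exact ⟨s, ⟨⟨hs.1.lt_of_ne' hs0, hs.2.trans_lt (sub_lt_self 1 (exp_pos _))⟩, h𝓔⟩, rfl⟩

/-- The square of the amplitude of the odd wave of energy `𝓔`. -/
def oddSqAmplitude (ω : ℝ) : ℝ → ℝ :=
  Function.invFunOn (oddEnergy ω) (oddAmplitudes ω)

theorem oddSqAmplitude_mem (hω : ω < 1) (h𝓔 : criticalEnergy ω < 𝓔) :
    oddSqAmplitude ω 𝓔 ∈ oddAmplitudes ω :=
  Function.invFunOn_mem (surjOn_oddEnergy hω h𝓔)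

theorem oddEnergy_oddSqAmplitude (hω : ω < 1) (h𝓔 : criticalEnergy ω < 𝓔) :
    oddEnergy ω (oddSqAmplitude ω 𝓔) = 𝓔 :=
  Function.invFunOn_eq (surjOn_oddEnergy hω h𝓔)

theorem contDiffOn_oddSqAmplitude (hω : ω < 1) {n : ℕ∞} :
    ContDiffOn ℝ n (oddSqAmplitude ω) (Ioi (criticalEnergy ω)) := by
  intro 𝓔 h𝓔
  have hs := oddSqAmplitude_mem hω h𝓔
  have hinv : ContDiffAt ℝ (⊤ : ℕ∞) (oddSqAmplitude ω) (oddEnergy ω (oddSqAmplitude ω 𝓔)) :=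
    contDiffAt_of_eventually_leftInverse (by simp) (contDiffAt_oddEnergy hω hs.1.2)
      (hasDerivAt_oddEnergy hω hs.1.2)
      (half_pos (oddDrop_pos hω hs (right_mem_Icc.2 zero_le_one))).ne'
      (eventually_of_mem ((isOpen_oddAmplitudes hω).mem_nhds hs)
        fun _ ht => (strictMonoOn_oddEnergy hω).injOn.leftInvOn_invFunOn ht)
  rw [oddEnergy_oddSqAmplitude hω h𝓔] at hinv
  exact (hinv.of_le (mod_cast le_top)).contDiffWithinAt

theorem strictMonoOn_oddSqAmplitude (hω : ω < 1) :
    StrictMonoOn (oddSqAmplitude ω) (Ioi (criticalEnergy ω)) := fun 𝓔 h𝓔 𝓕 h𝓕 hlt => by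
  rwa [← (strictMonoOn_oddEnergy hω).lt_iff_lt (oddSqAmplitude_mem hω h𝓔)
    (oddSqAmplitude_mem hω h𝓕), oddEnergy_oddSqAmplitude hω h𝓔, oddEnergy_oddSqAmplitude hω h𝓕]

theorem orbitRange_odd (hω : ω < 1) (hs : s ∈ oddAmplitudes ω) :
    orbitRange ω (oddEnergy ω s) = Icc (-√s) √s := by
  ext φ
  rw [mem_orbitRange, potential_eq_oddEnergy, mem_Icc, ← abs_le, le_sqrt (abs_nonneg φ) hs.1.1.le,
    sq_abs, mem_Ioo, ← abs_lt, ← sq_lt_one_iff_abs_lt_one]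
  constructor
  · rintro ⟨hφ, hle, -⟩
    exact (oddEnergy_le_oddEnergy_iff hω hs ⟨sq_nonneg φ, hφ⟩).1 hle
  · intro hle
    have hφ := hle.trans_lt hs.1.2
    exact ⟨hφ, (oddEnergy_le_oddEnergy_iff hω hs ⟨sq_nonneg φ, hφ⟩).2 hle,
      fun hlt => absurd hlt hs.2.not_gt⟩

theorem sin_sq_mem_Icc (θ : ℝ) : sin θ ^ 2 ∈ Icc (0 : ℝ) 1 :=
  ⟨sq_nonneg _, sin_sq_le_one θ⟩

theorem periodIntegrand_odd (hω : ω < 1) (hs : s ∈ oddAmplitudes ω) {θ : ℝ}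
    (hθ : θ ∈ Ioo (-(π / 2)) (π / 2)) :
    |√s * cos θ| * periodIntegrand ω (oddEnergy ω s) (√s * sin θ) =
      (√(oddDrop (1 - ω) s (sin θ ^ 2)))⁻¹ := by
  have hcos := cos_pos_of_mem_Ioo hθ
  have hsqrt := sqrt_pos.2 hs.1.1
  have hkinetic := oddEnergy_sub_oddEnergy_mul hω hs.1.2 (sin_sq_mem_Icc θ)
  rw [← cos_sq', mul_comm (sin θ ^ 2)] at hkinetic
  rw [periodIntegrand, potential_eq_oddEnergy, mul_pow, sq_sqrt hs.1.1.le, hkinetic,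
    sqrt_mul (mul_nonneg hs.1.1.le (sq_nonneg _)), sqrt_mul hs.1.1.le, sqrt_sq hcos.le,
    abs_of_pos (mul_pos hsqrt hcos)]
  field_simp

/-- Half the period of the odd wave of amplitude `√s`, with `a = 1 - ω`. -/
def oddHalfPeriod (a s : ℝ) : ℝ :=
  ∫ θ in -(π / 2)..π / 2, (√(oddDrop a s (sin θ ^ 2)))⁻¹

theorem contDiffAt_inv_sqrt_oddDrop (hω : ω < 1) (hs : s ∈ oddAmplitudes ω) (θ : ℝ) {n : ℕ∞} :
    ContDiffAt ℝ n (Function.uncurry fun s θ => (√(oddDrop (1 - ω) s (sin θ ^ 2)))⁻¹) (s, θ) := by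
  have hdrop := oddDrop_pos hω hs (sin_sq_mem_Icc θ)
  have hcomp : ContDiffAt ℝ n (fun p : ℝ × ℝ => oddDrop (1 - ω) p.1 (sin p.2 ^ 2)) (s, θ) :=
    (contDiffAt_oddDrop hs.1.2 (sin_sq_mem_Icc θ)).comp (s, θ)
      (f := fun p : ℝ × ℝ => (p.1, sin p.2 ^ 2)) (by fun_prop)
  exact (hcomp.sqrt hdrop.ne').inv (sqrt_pos.2 hdrop).ne'

theorem continuous_inv_sqrt_oddDrop (hω : ω < 1) (hs : s ∈ oddAmplitudes ω) :
    Continuous fun θ => (√(oddDrop (1 - ω) s (sin θ ^ 2)))⁻¹ :=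
  continuous_iff_continuousAt.2 fun θ =>
    (contDiffAt_inv_sqrt_oddDrop (n := 0) hω hs θ).continuousAt.comp
      (f := fun θ => (s, θ)) (by fun_prop)

theorem integral_orbitRange_odd (hω : ω < 1) (hs : s ∈ oddAmplitudes ω) :
    IntegrableOn (periodIntegrand ω (oddEnergy ω s)) (orbitRange ω (oddEnergy ω s)) ∧
      ∫ φ in orbitRange ω (oddEnergy ω s), periodIntegrand ω (oddEnergy ω s) φ =
        oddHalfPeriod (1 - ω) s := by
  have hsqrt := sqrt_pos.2 hs.1.1
  rw [orbitRange_odd hω hs, ← image_mul_sin hsqrt]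
  exact integral_image_Icc (by linarith [pi_pos]) (fun θ _ => (hasDerivAt_sin θ).const_mul √s)
    ((mul_right_injective₀ hsqrt.ne').injOn.comp injOn_sin (mapsTo_univ _ _))
    (continuous_inv_sqrt_oddDrop hω hs).continuousOn fun θ hθ => periodIntegrand_odd hω hs hθ

theorem contDiffOn_oddHalfPeriod (hω : ω < 1) {n : ℕ∞} :
    ContDiffOn ℝ n (oddHalfPeriod (1 - ω)) (oddAmplitudes ω) := fun _ hs =>
  (contDiffAt_intervalIntegral fun θ _ =>
    contDiffAt_inv_sqrt_oddDrop hω hs θ).contDiffWithinAt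

theorem strictAntiOn_oddHalfPeriod (hω : ω < 1) :
    StrictAntiOn (oddHalfPeriod (1 - ω)) (oddAmplitudes ω) := by
  intro s hs t ht hst
  refine intervalIntegral_lt_of_continuousOn (by linarith [pi_pos])
    (continuous_inv_sqrt_oddDrop hω ht).continuousOn
    (continuous_inv_sqrt_oddDrop hω hs).continuousOn fun θ hθ => ?_
  have hτ : sin θ ^ 2 ∈ Ico 0 1 := by
    refine ⟨sq_nonneg _, ?_⟩
    rw [sin_sq]
    linarith [pow_pos (cos_pos_of_mem_Ioo hθ) 2]
  have hdrop := oddDrop_pos hω hs (Ico_subset_Icc_self hτ)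
  exact inv_strictAnti₀ (sqrt_pos.2 hdrop) (sqrt_lt_sqrt hdrop.le
    (strictMonoOn_oddDrop (sub_pos.2 hω) hτ hs.1.2 ht.1.2 hst))

theorem integrableOn_periodIntegrand_odd (hω : ω < 1) (h𝓔 : criticalEnergy ω < 𝓔) :
    IntegrableOn (periodIntegrand ω 𝓔) (orbitRange ω 𝓔) := by
  simpa only [oddEnergy_oddSqAmplitude hω h𝓔] using
    (integral_orbitRange_odd hω (oddSqAmplitude_mem hω h𝓔)).1

theorem period_odd (hω : ω < 1) (h𝓔 : criticalEnergy ω < 𝓔) :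
    period 𝓔 ω = 2 * oddHalfPeriod (1 - ω) (oddSqAmplitude ω 𝓔) := by
  rw [period, ← (integral_orbitRange_odd hω (oddSqAmplitude_mem hω h𝓔)).2,
    oddEnergy_oddSqAmplitude hω h𝓔]

theorem contDiffOn_period_odd (hω : ω < 1) {n : ℕ∞} :
    ContDiffOn ℝ n (fun 𝓔 => period 𝓔 ω) (Ioi (criticalEnergy ω)) :=
  (contDiffOn_const.mul ((contDiffOn_oddHalfPeriod hω).comp (contDiffOn_oddSqAmplitude hω)
    fun _ h𝓔 => oddSqAmplitude_mem hω h𝓔)).congr fun _ h𝓔 => period_odd hω h𝓔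

theorem strictAntiOn_period_odd (hω : ω < 1) :
    StrictAntiOn (fun 𝓔 => period 𝓔 ω) (Ioi (criticalEnergy ω)) := by
  intro 𝓔 h𝓔 𝓕 h𝓕 hlt
  change period 𝓕 ω < period 𝓔 ω
  rw [period_odd hω h𝓔, period_odd hω h𝓕]
  exact mul_lt_mul_of_pos_left (strictAntiOn_oddHalfPeriod hω (oddSqAmplitude_mem hω h𝓔)
    (oddSqAmplitude_mem hω h𝓕) (strictMonoOn_oddSqAmplitude hω h𝓔 h𝓕 hlt)) two_pos

end OddWave

theorem contDiffOn_period {ω : ℝ} (hω₀ : 0 < ω) (hω₁ : ω < 1) {n : ℕ∞} :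
    ContDiffOn ℝ n (fun 𝓔 => period 𝓔 ω) (Ioi 0 \ {criticalEnergy ω}) := by
  rintro 𝓔 ⟨h𝓔, hne⟩
  rcases lt_or_gt_of_ne hne with hlt | hgt
  · exact ((contDiffOn_period_even hω₀ hω₁).contDiffAt
      (isOpen_Ioo.mem_nhds ⟨h𝓔, hlt⟩)).contDiffWithinAt
  · exact ((contDiffOn_period_odd hω₁).contDiffAt (isOpen_Ioi.mem_nhds hgt)).contDiffWithinAt

end NLSIDD

end

theorem theorem2_general (n : ℕ∞) :
    (∀ ω : ℝ, 0 < ω → ω < 1 → ∀ 𝓔 : ℝ, 0 < 𝓔 → 𝓔 < NLSIDD.criticalEnergy ω →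
      MeasureTheory.IntegrableOn (NLSIDD.periodIntegrand ω 𝓔) (NLSIDD.orbitRange ω 𝓔)) ∧
    (∀ ω : ℝ, ω < 1 → ∀ 𝓔 : ℝ, NLSIDD.criticalEnergy ω < 𝓔 →
      MeasureTheory.IntegrableOn (NLSIDD.periodIntegrand ω 𝓔) (NLSIDD.orbitRange ω 𝓔)) ∧
    (∀ ω : ℝ, 0 < ω → ω < 1 →
      ContDiffOn ℝ n (fun 𝓔 : ℝ => NLSIDD.period 𝓔 ω)
        (Set.Ioi 0 \ {NLSIDD.criticalEnergy ω})) ∧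
    (∀ ω : ℝ, ω < 1 →
      ContDiffOn ℝ n (fun 𝓔 : ℝ => NLSIDD.period 𝓔 ω)
        (Set.Ioi (NLSIDD.criticalEnergy ω))) ∧
    (∀ ω : ℝ, 0 < ω → ω < 1 →
      StrictMonoOn (fun 𝓔 : ℝ => NLSIDD.period 𝓔 ω)
        (Set.Ioo 0 (NLSIDD.criticalEnergy ω))) ∧
    (∀ ω : ℝ, ω < 1 →
      StrictAntiOn (fun 𝓔 : ℝ => NLSIDD.period 𝓔 ω)
        (Set.Ioi (NLSIDD.criticalEnergy ω))) :=
  ⟨fun _ hω₀ hω₁ _ h𝓔₀ h𝓔 => NLSIDD.integrableOn_periodIntegrand_even hω₀ hω₁ ⟨h𝓔₀, h𝓔⟩,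
    fun _ hω _ h𝓔 => NLSIDD.integrableOn_periodIntegrand_odd hω h𝓔,
    fun _ hω₀ hω₁ => NLSIDD.contDiffOn_period hω₀ hω₁,
    fun _ hω => NLSIDD.contDiffOn_period_odd hω,
    fun _ hω₀ hω₁ => NLSIDD.strictMonoOn_period_even hω₀ hω₁,
    fun _ hω => NLSIDD.strictAntiOn_period_odd hω⟩

theorem theorem2 :
    -- the integral that defines the period converges
    (∀ ω : ℝ, 0 < ω → ω < 1 → ∀ 𝓔 : ℝ, 0 < 𝓔 → 𝓔 < NLSIDD.criticalEnergy ω →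
      MeasureTheory.IntegrableOn (NLSIDD.periodIntegrand ω 𝓔) (NLSIDD.orbitRange ω 𝓔)) ∧
    (∀ ω : ℝ, ω < 1 → ∀ 𝓔 : ℝ, NLSIDD.criticalEnergy ω < 𝓔 →
      MeasureTheory.IntegrableOn (NLSIDD.periodIntegrand ω 𝓔) (NLSIDD.orbitRange ω 𝓔)) ∧
    -- smoothness
    (∀ ω : ℝ, 0 < ω → ω < 1 →
      ContDiffOn ℝ 1 (fun 𝓔 : ℝ => NLSIDD.period 𝓔 ω)
        (Set.Ioi 0 \ {NLSIDD.criticalEnergy ω})) ∧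
    (∀ ω : ℝ, ω < 0 →
      ContDiffOn ℝ 1 (fun 𝓔 : ℝ => NLSIDD.period 𝓔 ω)
        (Set.Ioi (NLSIDD.criticalEnergy ω))) ∧
    -- monotonicity for the even waves
    (∀ ω : ℝ, 0 < ω → ω < 1 →
      StrictMonoOn (fun 𝓔 : ℝ => NLSIDD.period 𝓔 ω)
        (Set.Ioo 0 (NLSIDD.criticalEnergy ω))) ∧
    -- monotonicity for the odd waves
    (∀ ω : ℝ, ω < 1 →
      StrictAntiOn (fun 𝓔 : ℝ => NLSIDD.period 𝓔 ω)
        (Set.Ioi (NLSIDD.criticalEnergy ω))) := by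
  obtain ⟨heven, hodd, hsmooth, hsmooth_odd, hmono, hanti⟩ := theorem2_general 1
  exact ⟨heven, hodd, hsmooth, fun ω hω => hsmooth_odd ω (hω.trans one_pos), hmono, hanti⟩
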